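/- Let $G$ be a finite group with identity $e$, and let $H$ be a Frobenius complement in $G$, i.e. a proper, non-trivial subgroup of $G$ with $H\cap gHg^{-1}=\{e\}$ for all $g\in G\setminus H$. Let $K=\bigl(G\setminus\bigcup_{g\in G}gHg^{-1}\bigr)\cup\{e\}$ be the corresponding Frobenius kernel (so that $G=K\rtimes H$). Suppose that $H$ is abelian of order $h$ and that $K$ is abelian of order $k$. Then $h$ divides $k-1$. Moreover: 1. $G$ has trivial centre; it has exactly $(k-1)/h$ conjugacy classes of size $h$ and exactly $h-1$ conjugacy classes of size $k$; and every conjugacy class other than $\{e\}$ has size $h$ or $k$. 2. Exactly $h$ of the irreducible complex characters of $G$ are linear (that is, are homomorphisms from $G$ to the unit circle), and every other irreducible complex character of $G$ has degree $h$, where the degree of a character $\chi$ is $\chi(e)$. -/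

import Mathlib

/-- `H` is a Frobenius complement in `G`: a proper, non-trivial subgroup which is malnormal, that is
`H ∩ gHg⁻¹ = {e}` for every `g ∈ G \ H`. (The finiteness of `G` is assumed separately.) -/
structure IsFrobeniusComplement {G : Type*} [Group G] (H : Subgroup G) : Prop where
  proper : H ≠ ⊤
  nontrivial : H ≠ ⊥
  malnormal : ∀ g : G, g ∉ H → H ⊓ H.map (MulAut.conj g).toMonoidHom = ⊥

/-- The Frobenius kernel `K = (G \ ⋃ g, gHg⁻¹) ∪ {e}`, as a subset of `G`. -/
def frobeniusKernel {G : Type*} [Group G] (H : Subgroup G) : Set G :=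
  (⋃ g : G, (H.map (MulAut.conj g).toMonoidHom : Set G))ᶜ ∪ {1}

/-- `Irr(G)`: the set of characters of irreducible finite-dimensional complex representations. Up to
isomorphism such a representation lives on `ℂⁿ` for some `n`. -/
def irrCharacters (G : Type*) [Group G] : Set (G → ℂ) :=
  {χ | ∃ (n : ℕ) (ρ : Representation ℂ G (Fin n → ℂ)), ρ.IsIrreducible ∧ ρ.character = χ}

/-- A character is linear if it is a homomorphism from `G` to the unit circle. -/
def IsLinearChar {G : Type*} [Group G] (χ : G → ℂ) : Prop :=
  ∃ φ : G →* Circle, ∀ g : G, χ g = (φ g : ℂ)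

/-! ### Counting and centralizers in a Frobenius group. -/

namespace IsFrobeniusComplement

variable {G : Type*} [Group G] {H : Subgroup G}

/-! Classes: by malnormality and commutativity, a non-trivial element of `H` has centralizer `H`,
and a non-trivial element of `K` has centralizer `K`. So `K` is a subgroup without any appeal to
Frobenius's theorem. Since `|K| = [G : H]`, the non-trivial classes have size `h` inside `K` and `k`
outside it; counting elements gives the rest.

Characters: for `1 ≠ y ∈ H`, the map `m ↦ [y, m]` is a bijection of `K` (`exists_commutator_eq`).
Hence homomorphisms to abelian groups kill `K`, and the linear characters are those of `G / K ≅ H`.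
An irreducible representation of degree other than one contains a joint eigenvector `v` for `K` with
non-trivial character `μ`. The `H`-conjugates of `μ` are distinct, so the `h` vectors `ρ y v` are
independent, and their span is `G`-invariant: the degree is `h`
(`finrank_eq_card_of_isIrreducible`). -/

theorem mem_of_conj_mem (hH : IsFrobeniusComplement H) {x g : G} (hx : x ∈ H) (hx1 : x ≠ 1)
    (hg : g * x * g⁻¹ ∈ H) : g ∈ H := by
  by_contra hgH
  have hmem : g * x * g⁻¹ ∈ H ⊓ H.map (MulAut.conj g).toMonoidHom :=
    ⟨hg, x, hx, by simp [MulAut.conj_apply]⟩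
  rw [hH.malnormal g hgH, Subgroup.mem_bot, conj_eq_one_iff] at hmem
  exact hx1 hmem

theorem _root_.mem_frobeniusKernel_iff {g : G} :
    g ∈ frobeniusKernel H ↔ g = 1 ∨ ∀ a x : G, x ∈ H → a * x * a⁻¹ ≠ g := by
  simp [frobeniusKernel]

theorem _root_.exists_conj_of_notMem_frobeniusKernel {g : G} (hg : g ∉ frobeniusKernel H) :
    ∃ a x : G, x ∈ H ∧ x ≠ 1 ∧ a * x * a⁻¹ = g := by
  rw [mem_frobeniusKernel_iff] at hg
  push Not at hg
  obtain ⟨h1, a, x, hx, rfl⟩ := hg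
  exact ⟨a, x, hx, by rintro rfl; simp at h1, rfl⟩

theorem _root_.one_mem_frobeniusKernel (H : Subgroup G) : (1 : G) ∈ frobeniusKernel H :=
  mem_frobeniusKernel_iff.2 (.inl rfl)

theorem _root_.conj_mem_frobeniusKernel {g : G} (hg : g ∈ frobeniusKernel H) (a : G) :
    a * g * a⁻¹ ∈ frobeniusKernel H := by
  rw [mem_frobeniusKernel_iff] at hg ⊢
  rcases hg with rfl | hg
  · simp
  · refine .inr fun b x hx h ↦ hg (a⁻¹ * b) x hx ?_
    rw [show a⁻¹ * b * x * (a⁻¹ * b)⁻¹ = a⁻¹ * (b * x * b⁻¹) * a by group, h]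
    group

theorem _root_.eq_one_of_mem_frobeniusKernel {g : G} (hg : g ∈ frobeniusKernel H)
    (hgH : g ∈ H) : g = 1 :=
  (mem_frobeniusKernel_iff.1 hg).resolve_right fun h ↦ h 1 g hgH (by simp)

/-- Malnormality makes the coset `aH` of a conjugator unique, so elements outside `K` correspond to
pairs of a coset and a non-trivial element of `H`. -/
theorem ncard_compl_frobeniusKernel [Finite G] (hH : IsFrobeniusComplement H) :
    ((frobeniusKernel H)ᶜ).ncard = H.index * (Nat.card H - 1) := by
  let f : (G ⧸ H) × {x : H // x ≠ 1} → ((frobeniusKernel H)ᶜ : Set G) := fun p ↦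
    ⟨p.1.out * p.2.1 * p.1.out⁻¹, fun h ↦ by
      rcases mem_frobeniusKernel_iff.1 h with h | h
      · rw [conj_eq_one_iff] at h
        exact p.2.2 (Subtype.ext h)
      · exact h _ _ p.2.1.2 rfl⟩
  have hf : Function.Bijective f := by
    constructor
    · rintro ⟨q, ⟨⟨x, hx⟩, hx1⟩⟩ ⟨p, ⟨⟨y, hy⟩, hy1⟩⟩ h
      have h' : q.out * x * q.out⁻¹ = p.out * y * p.out⁻¹ := congrArg Subtype.val h
      have hc : (p.out⁻¹ * q.out) * x * (p.out⁻¹ * q.out)⁻¹ = y := by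
        rw [show (p.out⁻¹ * q.out) * x * (p.out⁻¹ * q.out)⁻¹ =
          p.out⁻¹ * (q.out * x * q.out⁻¹) * p.out by group, h']
        group
      have hm : p.out⁻¹ * q.out ∈ H :=
        hH.mem_of_conj_mem hx (fun h ↦ hx1 (Subtype.ext h)) (hc ▸ hy)
      have hpq : p = q := by
        rw [← QuotientGroup.out_eq' p, ← QuotientGroup.out_eq' q]
        exact QuotientGroup.eq.2 hm
      subst hpq
      have hxy : x = y := by simpa using hc
      subst hxy
      rfl
    · rintro ⟨g, hg⟩
      obtain ⟨a, x, hx, hx1, rfl⟩ := exists_conj_of_notMem_frobeniusKernel hg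
      obtain ⟨z, hz⟩ := QuotientGroup.mk_out_eq_mul H a
      refine ⟨(↑a, ⟨⟨(z : G)⁻¹ * x * z, H.mul_mem (H.mul_mem (H.inv_mem z.2) hx) z.2⟩,
        fun h ↦ hx1 ?_⟩), Subtype.ext ?_⟩
      · have h' : (z : G)⁻¹ * x * z = 1 := congrArg Subtype.val h
        simpa using (conj_eq_one_iff (a := (z : G)⁻¹) (b := x)).1 (by simpa using h')
      · change (a : G ⧸ H).out * ((z : G)⁻¹ * x * z) * (a : G ⧸ H).out⁻¹ = a * x * a⁻¹
        rw [hz]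
        group
  rw [← Nat.card_coe_set_eq, ← Nat.card_congr (Equiv.ofBijective f hf), Nat.card_prod,
    Subgroup.index]
  congr 1
  have := Set.ncard_compl ({1} : Set H)
  rw [Set.ncard_singleton] at this
  exact this

theorem one_lt_card [Finite G] (hH : IsFrobeniusComplement H) : 1 < Nat.card H :=
  (Subgroup.one_lt_card_iff_ne_bot H).2 hH.nontrivial

theorem ncard_frobeniusKernel [Finite G] (hH : IsFrobeniusComplement H) :
    (frobeniusKernel H).ncard = H.index := by
  have h1 := Set.ncard_add_ncard_compl (frobeniusKernel H)
  rw [hH.ncard_compl_frobeniusKernel, ← H.index_mul_card] at h1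
  have h2 := hH.one_lt_card
  obtain ⟨m, hm⟩ : ∃ m, Nat.card H = m + 1 := ⟨Nat.card H - 1, by omega⟩
  rw [hm, Nat.add_sub_cancel, mul_add, mul_one] at h1
  omega

theorem one_lt_ncard_frobeniusKernel [Finite G] (hH : IsFrobeniusComplement H) :
    1 < (frobeniusKernel H).ncard := by
  rw [hH.ncard_frobeniusKernel]
  have h0 := H.index_ne_zero_of_finite
  have h1 := mt Subgroup.index_eq_one.1 hH.proper
  omega

theorem centralizer_eq_of_mem (hH : IsFrobeniusComplement H)
    (hcomm : ∀ x ∈ H, ∀ y ∈ H, x * y = y * x) {y : G} (hy : y ∈ H) (hy1 : y ≠ 1) :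
    Subgroup.centralizer {y} = H := by
  ext g
  rw [Subgroup.mem_centralizer_singleton_iff]
  refine ⟨fun h ↦ hH.mem_of_conj_mem hy hy1 ?_, fun h ↦ (hcomm g h y hy)⟩
  rw [show g * y * g⁻¹ = y by rw [h]; group]
  exact hy

theorem commute_eq_one (hH : IsFrobeniusComplement H) {x y : G} (hx : x ∈ frobeniusKernel H)
    (hy : y ∈ H) (hy1 : y ≠ 1) (h : x * y = y * x) : x = 1 := by
  refine eq_one_of_mem_frobeniusKernel hx (hH.mem_of_conj_mem hy hy1 ?_)
  rw [show x * y * x⁻¹ = y by rw [h]; group]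
  exact hy

/-- An element outside `K` commuting with `x` can be conjugated into `H`; the same conjugate of `x`
stays in `K`, so `commute_eq_one` makes it trivial. -/
theorem coe_centralizer_of_mem_frobeniusKernel (hH : IsFrobeniusComplement H)
    (hcomm : ∀ x ∈ frobeniusKernel H, ∀ y ∈ frobeniusKernel H, x * y = y * x) {x : G}
    (hx : x ∈ frobeniusKernel H) (hx1 : x ≠ 1) :
    (Subgroup.centralizer {x} : Set G) = frobeniusKernel H := by
  ext g
  rw [SetLike.mem_coe, Subgroup.mem_centralizer_singleton_iff]
  refine ⟨fun h ↦ ?_, fun h ↦ hcomm g h x hx⟩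
  by_contra hg
  obtain ⟨a, y, hy, hy1, rfl⟩ := exists_conj_of_notMem_frobeniusKernel hg
  have := hH.commute_eq_one (conj_mem_frobeniusKernel hx a⁻¹) hy hy1 (by
    calc a⁻¹ * x * a⁻¹⁻¹ * y = a⁻¹ * (x * (a * y * a⁻¹)) * a := by group
      _ = a⁻¹ * (a * y * a⁻¹ * x) * a := by rw [h]
      _ = y * (a⁻¹ * x * a⁻¹⁻¹) := by group)
  exact hx1 (conj_eq_one_iff.1 this)

/-- An abelian Frobenius kernel is a subgroup. -/
theorem exists_subgroup_coe_eq [Finite G] (hH : IsFrobeniusComplement H)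
    (hcomm : ∀ x ∈ frobeniusKernel H, ∀ y ∈ frobeniusKernel H, x * y = y * x) :
    ∃ N : Subgroup G, (N : Set G) = frobeniusKernel H := by
  obtain ⟨x, hx, hx1⟩ := Set.exists_ne_of_one_lt_ncard hH.one_lt_ncard_frobeniusKernel 1
  exact ⟨_, hH.coe_centralizer_of_mem_frobeniusKernel hcomm hx hx1⟩

section Kernel

variable {N : Subgroup G}

theorem normal_of_coe_eq (hN : (N : Set G) = frobeniusKernel H) : N.Normal where
  conj_mem x hx g := by
    rw [← SetLike.mem_coe, hN] at hx ⊢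
    exact conj_mem_frobeniusKernel hx g

theorem isComplement' [Finite G] (hH : IsFrobeniusComplement H)
    (hN : (N : Set G) = frobeniusKernel H) : H.IsComplement' N := by
  refine Subgroup.isComplement'_of_card_mul_and_disjoint ?_ ?_
  · rw [← SetLike.coe_sort_coe N, hN, Nat.card_coe_set_eq, hH.ncard_frobeniusKernel,
      H.card_mul_index]
  · rw [Subgroup.disjoint_def]
    intro x hx hxN
    exact eq_one_of_mem_frobeniusKernel (hN ▸ hxN) hx

/-- Commutation with a non-trivial element of the complement maps a Frobenius kernel that is a
subgroup onto itself. -/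
theorem exists_commutator_eq [Finite G] (hH : IsFrobeniusComplement H)
    (hN : (N : Set G) = frobeniusKernel H)
    {y : G} (hy : y ∈ H) (hy1 : y ≠ 1) {n : G} (hn : n ∈ N) :
    ∃ m ∈ N, y * m * y⁻¹ * m⁻¹ = n := by
  have hnorm := normal_of_coe_eq hN
  let f : N → N := fun m ↦ ⟨y * m * y⁻¹ * (m : G)⁻¹,
    N.mul_mem (hnorm.conj_mem _ m.2 y) (N.inv_mem m.2)⟩
  -- Equal commutators mean that `y` centralizes `b⁻¹ * a`; finiteness then turns injectivity into
  -- surjectivity.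
  have hf : Function.Injective f := by
    intro a b hab
    have h : y * a * y⁻¹ * (a : G)⁻¹ = y * b * y⁻¹ * (b : G)⁻¹ := congrArg Subtype.val hab
    have hw : (b : G)⁻¹ * a ∈ N := N.mul_mem (N.inv_mem b.2) a.2
    have h1 : y * ((b : G)⁻¹ * a) * y⁻¹ = (b : G)⁻¹ * a := by
      calc y * ((b : G)⁻¹ * a) * y⁻¹ = (y * b * y⁻¹)⁻¹ * (y * a * y⁻¹ * (a : G)⁻¹) * a := by group
        _ = (b : G)⁻¹ * a := by rw [h]; group
    have h2 : (b : G)⁻¹ * a = 1 := by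
      refine hH.commute_eq_one (hN ▸ hw) hy hy1 ?_
      nth_rewrite 1 [← h1]
      group
    exact (Subtype.ext (inv_mul_eq_one.1 h2)).symm
  obtain ⟨m, hm⟩ := (Finite.injective_iff_surjective.1 hf) ⟨n, hn⟩
  exact ⟨m, m.2, congrArg Subtype.val hm⟩

end Kernel

end IsFrobeniusComplement

/-! ### Sizes of conjugacy classes. -/

section ConjClasses

theorem ConjClasses.ncard_carrier_mk_mul_card_centralizer {G : Type*} [Group G] (g : G) :
    (ConjClasses.mk g).carrier.ncard * Nat.card (Subgroup.centralizer {g}) = Nat.card G := by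
  have h := Subgroup.nat_card_centralizer_nat_card_stabilizer g
  have h2 := Subgroup.card_mul_index (MulAction.stabilizer (ConjAct G) g)
  rw [MulAction.index_stabilizer, ConjAct.orbit_eq_carrier_conjClasses, ← h] at h2
  rw [mul_comm, h2]
  rfl

theorem ConjClasses.ncard_setOf_mk_mem {G : Type*} [Group G] [Finite G] (T : Set (ConjClasses G)) (m : ℕ)
    (hT : ∀ C ∈ T, C.carrier.ncard = m) : {g : G | ConjClasses.mk g ∈ T}.ncard = m * T.ncard := by
  classical
  have := Fintype.ofFinite G
  have : Finite (ConjClasses G) := Quotient.finite _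
  have := Fintype.ofFinite (ConjClasses G)
  rw [Set.ncard_eq_toFinset_card', Set.ncard_eq_toFinset_card' T,
    Finset.card_eq_sum_card_fiberwise (f := ConjClasses.mk) (t := T.toFinset)
      (by intro g hg; simpa using hg), mul_comm, ← smul_eq_mul]
  refine Finset.sum_eq_card_nsmul fun C hC ↦ ?_
  rw [← hT C (by simpa using hC), Set.ncard_eq_toFinset_card']
  congr 1
  ext g
  simp only [Finset.mem_filter, Set.mem_toFinset, Set.mem_ofPred_eq,
    ConjClasses.mem_carrier_iff_mk_eq]
  exact ⟨fun h ↦ h.2, fun h ↦ ⟨h ▸ by simpa using hC, h⟩⟩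

end ConjClasses

/-! ### Joint eigenvectors of commuting operators. -/

section JointEigenvectors

variable {ι K V : Type*} [Field K] [AddCommGroup V] [Module K V]

theorem Module.End.exists_joint_eigenvector [IsAlgClosed K] [FiniteDimensional K V] [Nontrivial V]
    (f : ι → Module.End K V) (hf : ∀ i j, Commute (f i) (f j)) :
    ∃ v : V, v ≠ 0 ∧ ∃ μ : ι → K, ∀ i, f i v = μ i • v := by
  -- On a minimal non-zero invariant subspace every `f i` is scalar: its eigenspaces there are
  -- invariant under the whole family.
  obtain ⟨W, hW⟩ := exists_minimal_of_wellFoundedLT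
    (fun W : Submodule K V ↦ W ≠ ⊥ ∧ ∀ i, ∀ v ∈ W, f i v ∈ W) ⟨⊤, top_ne_bot, by simp⟩
  obtain ⟨v, hv, hv0⟩ := W.ne_bot_iff.1 hW.prop.1
  have : Nontrivial W := (Submodule.nontrivial_iff_ne_bot).2 hW.prop.1
  have key : ∀ i, ∃ c : K, ∀ w ∈ W, f i w = c • w := by
    intro i
    obtain ⟨c, hc⟩ := Module.End.exists_eigenvalue ((f i).restrict (hW.prop.2 i))
    obtain ⟨w, hw⟩ := hc.exists_hasEigenvector
    have hw1 : f i w = c • (w : V) := congrArg Subtype.val hw.apply_eq_smul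
    refine ⟨c, fun u hu ↦ ?_⟩
    have hle : W ≤ W ⊓ (f i).eigenspace c := by
      refine hW.le_of_le ⟨?_, ?_⟩ inf_le_left
      · refine (Submodule.ne_bot_iff _).2 ⟨w, ⟨w.2, Module.End.mem_eigenspace_iff.2 hw1⟩, ?_⟩
        simpa using hw.2
      · rintro j x ⟨hxW, hx⟩
        refine ⟨hW.prop.2 j x hxW, ?_⟩
        rw [SetLike.mem_coe, Module.End.mem_eigenspace_iff] at hx ⊢
        have := LinearMap.congr_fun (hf i j).eq x
        simp only [Module.End.mul_apply] at this
        rw [this, hx, map_smul]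
    exact Module.End.mem_eigenspace_iff.1 (hle hu).2
  choose μ hμ using key
  exact ⟨v, hv0, μ, fun i ↦ hμ i v hv⟩

theorem Module.End.linearIndependent_of_joint_eigenvectors {κ : Type*} (f : ι → Module.End K V)
    (hf : ∀ i j, Commute (f i) (f j)) (v : κ → V) (hv : ∀ a, v a ≠ 0) (μ : κ → ι → K)
    (hμ : Function.Injective μ) (h : ∀ a i, f i (v a) = μ a i • v a) : LinearIndependent K v := by
  have hind := Module.End.independent_iInf_maxGenEigenspace_of_forall_mapsTo f
    fun i j φ ↦ Module.End.mapsTo_maxGenEigenspace_of_comm (hf j i) φ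
  refine (hind.comp hμ).linearIndependent _ (fun a ↦ ?_) hv
  rw [Function.comp_apply, Submodule.mem_iInf]
  intro i
  refine ((f i).genEigenspace (μ a i)).mono le_top (a := 1) ?_
  exact Module.End.mem_eigenspace_iff.2 (h a i)

end JointEigenvectors

/-! ### Irreducible representations and linear characters. -/

namespace Representation

section Irreducible

variable {k G V : Type*} [Field k] [Monoid G] [AddCommGroup V] [Module k V]
  {ρ : Representation k G V}

theorem IsIrreducible.eq_top_of_invariant (hρ : ρ.IsIrreducible) (W : Submodule k V)
    (hW : ∀ g, ∀ v ∈ W, ρ g v ∈ W) {v : V} (hv : v ∈ W) (hv0 : v ≠ 0) : W = ⊤ := by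
  rcases hρ.eq_bot_or_eq_top ⟨W, fun g v hv ↦ hW g v hv⟩ with h | h
  · have : W = ⊥ := congrArg Subrepresentation.toSubmodule h
    exact absurd (by simpa [this] using hv) hv0
  · exact congrArg Subrepresentation.toSubmodule h

theorem IsIrreducible.nontrivial (hρ : ρ.IsIrreducible) : Nontrivial V := by
  by_contra h
  rw [not_nontrivial_iff_subsingleton] at h
  obtain ⟨A, B, hAB⟩ := hρ.toNontrivial
  exact hAB (Subrepresentation.toSubmodule_injective (Subsingleton.elim _ _))

theorem isIrreducible_of_finrank_eq_one (ρ : Representation k G V)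
    (h : Module.finrank k V = 1) : ρ.IsIrreducible where
  exists_pair_ne := by
    have := Module.nontrivial_of_finrank_eq_succ h
    exact ⟨⊥, ⊤, fun e ↦ bot_ne_top (α := Submodule k V)
      (congrArg Subrepresentation.toSubmodule e)⟩
  eq_bot_or_eq_top A := by
    have := isSimpleModule_iff_finrank_eq_one.2 h
    exact (eq_bot_or_eq_top A.toSubmodule).imp
      (fun e ↦ Subrepresentation.toSubmodule_injective e)
      (fun e ↦ Subrepresentation.toSubmodule_injective e)

theorem IsIrreducible.finrank_eq_one_of_commute [IsAlgClosed k] [FiniteDimensional k V]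
    (hρ : ρ.IsIrreducible) (h : ∀ g g', Commute (ρ g) (ρ g')) : Module.finrank k V = 1 := by
  have := hρ.nontrivial
  obtain ⟨v, hv, μ, hμ⟩ := Module.End.exists_joint_eigenvector (fun g ↦ ρ g) h
  have htop : Submodule.span k {v} = ⊤ := by
    refine hρ.eq_top_of_invariant _ (fun g w hw ↦ ?_) (Submodule.mem_span_singleton_self v) hv
    obtain ⟨c, rfl⟩ := Submodule.mem_span_singleton.1 hw
    rw [map_smul, hμ]
    exact Submodule.smul_mem _ _ (Submodule.smul_mem _ _ (Submodule.mem_span_singleton_self v))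
  rw [← finrank_top, ← htop, finrank_span_singleton hv]

end Irreducible

theorem isLinearChar_of_finrank_eq_one {G : Type*} [Group G] [Finite G]
    (ρ : Representation ℂ G (Fin 1 → ℂ)) : IsLinearChar ρ.character := by
  -- In dimension one the trace is the determinant, which is multiplicative; finite order puts its
  -- values on the unit circle.
  have hdet : ∀ g, ρ.character g = LinearMap.det (ρ g) := by
    intro g
    rw [Representation.character, LinearMap.trace_eq_matrix_trace ℂ (Pi.basisFun ℂ (Fin 1)),
      ← LinearMap.det_toMatrix (Pi.basisFun ℂ (Fin 1)), Matrix.trace_fin_one, Matrix.det_fin_one]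
  have hnorm : ∀ g, LinearMap.det (ρ g) ∈ Submonoid.unitSphere ℂ := by
    intro g
    rw [Submonoid.unitSphere, Submonoid.mem_mk]
    refine mem_sphere_zero_iff_norm.2 (Complex.norm_eq_one_of_pow_eq_one (n := orderOf g) ?_
      (orderOf_pos g).ne')
    rw [← map_pow, ← map_pow, pow_orderOf_eq_one, map_one, map_one]
  exact ⟨((LinearMap.det : _ →* ℂ).comp ρ).codRestrict (Submonoid.unitSphere ℂ) hnorm, hdet⟩

end Representation

theorem MonoidHom.coe_circle_mem_irrCharacters {G : Type*} [Group G] (φ : G →* Circle) :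
    (fun g ↦ (φ g : ℂ)) ∈ irrCharacters G := by
  refine ⟨1, (Module.toModuleEnd ℂ (S := ℂ) (Fin 1 → ℂ)).toMonoidHom.comp (Circle.coeHom.comp φ),
    Representation.isIrreducible_of_finrank_eq_one _ (by simp), ?_⟩
  ext g
  simp [Representation.character, LinearMap.trace_eq_matrix_trace ℂ (Pi.basisFun ℂ (Fin 1)),
    Matrix.trace_fin_one]
  rfl

/-! ### Characters of a Frobenius group with abelian complement and kernel. -/

namespace IsFrobeniusComplement

variable {G : Type*} [Group G] [Finite G] {H N : Subgroup G}

theorem exists_retraction (hH : IsFrobeniusComplement H) (hN : (N : Set G) = frobeniusKernel H) :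
    ∃ r : G →* H, ∀ y : H, r y = y := by
  have := normal_of_coe_eq hN
  let e := (hH.isComplement' hN).QuotientMulEquiv
  refine ⟨e.toMonoidHom.comp (QuotientGroup.mk' N), fun y ↦ ?_⟩
  change e (e.symm y) = y
  exact e.apply_symm_apply y

theorem exists_mul_eq (hH : IsFrobeniusComplement H) (hN : (N : Set G) = frobeniusKernel H)
    (g : G) : ∃ y ∈ H, ∃ n ∈ N, y * n = g := by
  obtain ⟨⟨y, n⟩, h⟩ := (hH.isComplement' hN).2 g
  exact ⟨y, y.2, n, n.2, h⟩

theorem map_eq_one_of_mem {A : Type*} [CommGroup A] (hH : IsFrobeniusComplement H)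
    (hN : (N : Set G) = frobeniusKernel H) (φ : G →* A) {n : G} (hn : n ∈ N) : φ n = 1 := by
  obtain ⟨y, hy, hy1⟩ := H.bot_or_exists_ne_one.resolve_left hH.nontrivial
  obtain ⟨m, -, rfl⟩ := hH.exists_commutator_eq hN hy hy1 hn
  simp

theorem ncard_linear_irrCharacters (hH : IsFrobeniusComplement H)
    (hcomm : ∀ x ∈ H, ∀ y ∈ H, x * y = y * x) (hN : (N : Set G) = frobeniusKernel H) :
    {χ ∈ irrCharacters G | IsLinearChar χ}.ncard = Nat.card H := by
  let _ : CommGroup H := { (inferInstance : Group H) with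
    mul_comm := fun x y ↦ Subtype.ext (hcomm x x.2 y y.2) }
  obtain ⟨r, hr⟩ := hH.exists_retraction hN
  let F : (H →* Circle) → (G → ℂ) := fun ψ g ↦ (ψ (r g) : ℂ)
  have hF : Function.Injective F := by
    intro ψ ψ' h
    ext y
    simpa [F, hr] using congrFun h y
  have hrange : {χ ∈ irrCharacters G | IsLinearChar χ} = Set.range F := by
    ext χ
    constructor
    · rintro ⟨-, φ, hφ⟩
      refine ⟨φ.comp H.subtype, funext fun g ↦ ?_⟩
      obtain ⟨y, hy, n, hn, rfl⟩ := hH.exists_mul_eq hN g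
      have h1 : r (y * n) = ⟨y, hy⟩ := by
        rw [map_mul, hH.map_eq_one_of_mem hN r hn, mul_one]
        exact hr ⟨y, hy⟩
      simp [F, h1, hφ, hH.map_eq_one_of_mem hN φ hn]
    · rintro ⟨ψ, rfl⟩
      exact ⟨(ψ.comp r).coe_circle_mem_irrCharacters, ψ.comp r, fun g ↦ rfl⟩
  -- Passing to `Circleˣ` gives the form in which duality says that the finite abelian group `H` has
  -- `|H|` characters.
  rw [hrange, ← Set.image_univ, Set.ncard_image_of_injective _ hF, Set.ncard_univ,
    Nat.card_congr (MulEquiv.monoidHomCongrRight (toUnits : Circle ≃* Circleˣ)).toEquiv,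
    CommGroup.card_monoidHom_of_hasEnoughRootsOfUnity]

theorem finrank_eq_card_of_isIrreducible {V : Type*} [AddCommGroup V] [Module ℂ V]
    [FiniteDimensional ℂ V] (hH : IsFrobeniusComplement H)
    (hcomm : ∀ x ∈ H, ∀ y ∈ H, x * y = y * x) (hN : (N : Set G) = frobeniusKernel H)
    (hNcomm : ∀ x ∈ N, ∀ y ∈ N, x * y = y * x) (ρ : Representation ℂ G V)
    (hρ : ρ.IsIrreducible) (h1 : Module.finrank ℂ V ≠ 1) : Module.finrank ℂ V = Nat.card H := by
  classical
  have := hρ.nontrivial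
  have := Fintype.ofFinite H
  have hnorm := normal_of_coe_eq hN
  have hNρ : ∀ x y : N, Commute (ρ x) (ρ y) := fun x y ↦ by
    rw [Commute, SemiconjBy, ← map_mul, ← map_mul, hNcomm x x.2 y y.2]
  obtain ⟨v, hv, μ, hμ⟩ := Module.End.exists_joint_eigenvector (fun x : N ↦ ρ x) hNρ
  have hμ1 : ∃ x, μ x ≠ 1 := by
    by_contra! hμ1
    refine h1 (hρ.finrank_eq_one_of_commute ?_)
    -- The vectors fixed by `N` form an invariant subspace because `N` is normal. It contains `v`,
    -- so `N` acts trivially and `ρ` factors through an abelian quotient.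
    have htop : (⨅ x : N, (ρ x).eqLocus LinearMap.id) = ⊤ := by
      refine hρ.eq_top_of_invariant _ (fun g w hw ↦ ?_) (v := v) ?_ hv
      · rw [Submodule.mem_iInf] at hw ⊢
        intro x
        have := hw ⟨g⁻¹ * x * g, by simpa using hnorm.conj_mem x x.2 g⁻¹⟩
        rw [LinearMap.mem_eqLocus, LinearMap.id_apply] at this ⊢
        rw [← Module.End.mul_apply, ← map_mul, show (x : G) * g = g * (g⁻¹ * x * g) by group,
          map_mul, Module.End.mul_apply, this]
      · rw [Submodule.mem_iInf]
        intro x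
        rw [LinearMap.mem_eqLocus, hμ, hμ1, one_smul, LinearMap.id_apply]
    have hρN : ∀ n ∈ N, ρ n = 1 := by
      intro n hn
      ext w
      have hw : w ∈ ⨅ x : N, (ρ x).eqLocus LinearMap.id := htop ▸ Submodule.mem_top
      exact (Submodule.mem_iInf _).1 hw ⟨n, hn⟩
    intro g g'
    obtain ⟨y, hy, n, hn, rfl⟩ := hH.exists_mul_eq hN g
    obtain ⟨y', hy', n', hn', rfl⟩ := hH.exists_mul_eq hN g'
    rw [map_mul, map_mul, hρN n hn, hρN n' hn', mul_one, mul_one, Commute, SemiconjBy, ← map_mul,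
      ← map_mul, hcomm y hy y' hy']
  have hμmul : ∀ x y : N, μ (x * y) = μ x * μ y := by
    intro x y
    refine smul_left_injective ℂ hv ?_
    simp only
    rw [← hμ, Subgroup.coe_mul, map_mul, Module.End.mul_apply, hμ, map_smul, hμ, smul_smul,
      mul_comm]
  -- `ρ y v` is a joint eigenvector for the conjugate character `x ↦ μ (y⁻¹ x y)`.
  let c : H → N → N := fun y x ↦ ⟨(y : G)⁻¹ * x * y, by simpa using hnorm.conj_mem x x.2 (y : G)⁻¹⟩
  have hc : ∀ (y : H) (x : N), ρ x (ρ y v) = μ (c y x) • ρ y v := by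
    intro y x
    rw [← map_smul, ← hμ, ← Module.End.mul_apply, ← Module.End.mul_apply, ← map_mul, ← map_mul]
    congr 2
    simp only [c]
    group
  have hinj : Function.Injective fun (y : H) (x : N) ↦ μ (c y x) := by
    intro y z hyz
    by_contra hne
    obtain ⟨x, hx⟩ := hμ1
    refine hx ?_
    have hzy : (z : G)⁻¹ * y ≠ 1 := fun h ↦ hne (Subtype.ext (inv_mul_eq_one.1 h).symm)
    obtain ⟨m, hm, hmx⟩ := hH.exists_commutator_eq hN (H.mul_mem (H.inv_mem z.2) y.2) hzy x.2
    -- Chosen so that `c y m' = m` and `c z m' = [z⁻¹ y, m] m = x m`; equal conjugates of `μ` then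
    -- force `μ x = 1`.
    let m' : N := ⟨y * m * (y : G)⁻¹, hnorm.conj_mem m hm y⟩
    have e1 : c z m' = x * c y m' := by
      apply Subtype.ext
      simp only [c, m', Subgroup.coe_mul, ← hmx]
      group
    have e2 : μ (c y m') = μ x * μ (c y m') := by
      rw [← hμmul, ← e1]
      exact congrFun hyz m'
    have e3 : μ (c y m') ≠ 0 := by
      intro h0
      have h2 := hμ (c y m')
      rw [h0, zero_smul] at h2
      have h3 : ρ ((c y m' : G)⁻¹) (ρ (c y m') v) = v := by simp
      rw [h2, map_zero] at h3
      exact hv h3.symm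
    exact mul_right_cancel₀ e3 (by rw [← e2, one_mul])
  have hlin : LinearIndependent ℂ fun y : H ↦ ρ y v :=
    Module.End.linearIndependent_of_joint_eigenvectors (fun x : N ↦ ρ x) hNρ _
      (fun y h0 ↦ hv (by simpa using congrArg (ρ (y : G)⁻¹) h0)) _ hinj hc
  have hspan : Submodule.span ℂ (Set.range fun y : H ↦ ρ y v) = ⊤ := by
    refine hρ.eq_top_of_invariant _ (fun g w hw ↦ ?_)
      (v := v) (Submodule.subset_span ⟨1, by simp⟩) hv
    induction hw using Submodule.span_induction with
    | mem w hw =>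
      obtain ⟨y, rfl⟩ := hw
      obtain ⟨z, hz, n, hn, hg⟩ := hH.exists_mul_eq hN g
      have : ρ g (ρ y v) = μ (c y ⟨n, hn⟩) • ρ (⟨z, hz⟩ * y : H) v := by
        rw [← hg, map_mul, Module.End.mul_apply, hc y ⟨n, hn⟩, map_smul, Subgroup.coe_mul, map_mul,
          Module.End.mul_apply]
      rw [this]
      exact Submodule.smul_mem _ _ (Submodule.subset_span ⟨_, rfl⟩)
    | zero => simp
    | add a b _ _ ha hb => rw [map_add]; exact Submodule.add_mem _ ha hb
    | smul a b _ hb => rw [map_smul]; exact Submodule.smul_mem _ _ hb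
  rw [← finrank_top, ← hspan, finrank_span_eq_card hlin, Nat.card_eq_fintype_card]

end IsFrobeniusComplement

/-! ### Assembly of the class and character counts. -/

theorem proposition3p2 {G : Type*} [Group G] [Finite G] (H : Subgroup G)
    (hH : IsFrobeniusComplement H) (h k : ℕ)
    (hHcomm : ∀ x ∈ H, ∀ y ∈ H, x * y = y * x)
    (hKcomm : ∀ x ∈ frobeniusKernel H, ∀ y ∈ frobeniusKernel H, x * y = y * x)
    (hh : Nat.card H = h) (hk : (frobeniusKernel H).ncard = k) :
    h ∣ k - 1 ∧
    Subgroup.center G = ⊥ ∧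
    {C : ConjClasses G | C.carrier.ncard = h}.ncard = (k - 1) / h ∧
    {C : ConjClasses G | C.carrier.ncard = k}.ncard = h - 1 ∧
    (∀ C : ConjClasses G, C.carrier = {1} ∨ C.carrier.ncard = h ∨ C.carrier.ncard = k) ∧
    {χ ∈ irrCharacters G | IsLinearChar χ}.ncard = h ∧
    (∀ χ ∈ irrCharacters G, ¬ IsLinearChar χ → χ 1 = (h : ℂ)) := by
  obtain ⟨N, hN⟩ := hH.exists_subgroup_coe_eq hKcomm
  have hNcomm : ∀ x ∈ N, ∀ y ∈ N, x * y = y * x := fun x hx y hy ↦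
    hKcomm x (hN ▸ hx) y (hN ▸ hy)
  have hh1 : 1 < h := hh ▸ hH.one_lt_card
  have hk1 : 1 < k := hk ▸ hH.one_lt_ncard_frobeniusKernel
  have hcard : h * k = Nat.card G := by
    rw [← hh, ← hk, hH.ncard_frobeniusKernel, H.card_mul_index]
  have hone : (ConjClasses.mk (1 : G)).carrier = {1} := by
    ext g
    simp [ConjClasses.mem_carrier_iff_mk_eq, ConjClasses.mk_eq_mk_iff_isConj]
  have hker : ∀ g ∈ frobeniusKernel H, g ≠ 1 → (ConjClasses.mk g).carrier.ncard = h := by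
    intro g hg hg1
    have e := ConjClasses.ncard_carrier_mk_mul_card_centralizer g
    rw [← SetLike.coe_sort_coe, hH.coe_centralizer_of_mem_frobeniusKernel hKcomm hg hg1,
      Nat.card_coe_set_eq, hk, ← hcard] at e
    exact Nat.eq_of_mul_eq_mul_right (by omega) e
  have hcompl : ∀ g ∉ frobeniusKernel H, (ConjClasses.mk g).carrier.ncard = k := by
    intro g hg
    obtain ⟨a, y, hy, hy1, rfl⟩ := exists_conj_of_notMem_frobeniusKernel hg
    have e := ConjClasses.ncard_carrier_mk_mul_card_centralizer y
    rw [hH.centralizer_eq_of_mem hHcomm hy hy1, hh, ← hcard, mul_comm] at e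
    rw [← ConjClasses.mk_eq_mk_iff_isConj.2 (isConj_iff.2 ⟨a, rfl⟩)]
    exact Nat.eq_of_mul_eq_mul_left (by omega) e
  have hcount_h := ConjClasses.ncard_setOf_mk_mem {C : ConjClasses G | C.carrier.ncard = h} h
    fun C hC ↦ hC
  have hcount_k := ConjClasses.ncard_setOf_mk_mem {C : ConjClasses G | C.carrier.ncard = k} k
    fun C hC ↦ hC
  have hcases : ∀ g : G, g = 1 ∨ (g ∈ frobeniusKernel H ∧ g ≠ 1) ∨ g ∉ frobeniusKernel H := by
    intro g; tauto
  -- Needed to separate the two families of classes. If `h = k`, all non-trivial classes have size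
  -- `h`, so `h` divides `h * h - 1`, hence `1`.
  have hne : h ≠ k := by
    rintro rfl
    have hset : {g : G | ConjClasses.mk g ∈ {C : ConjClasses G | C.carrier.ncard = h}} = {1}ᶜ := by
      ext g
      simp only [Set.mem_ofPred_eq, Set.mem_compl_iff, Set.mem_singleton_iff]
      refine ⟨?_, fun e ↦ ?_⟩
      · rintro e rfl
        rw [hone, Set.ncard_singleton] at e
        omega
      · rcases hcases g with hg | hg | hg
        exacts [absurd hg e, hker g hg.1 hg.2, hcompl g hg]
    rw [hset, Set.ncard_compl, Set.ncard_singleton, ← hcard] at hcount_h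
    have hdvd : h ∣ 1 :=
      (Nat.dvd_sub_iff_right (Nat.mul_pos (by omega) (by omega)) (dvd_mul_right h h)).1
        ⟨_, hcount_h⟩
    exact hh1.ne' (Nat.dvd_one.1 hdvd)
  have hset_h : {g : G | ConjClasses.mk g ∈ {C : ConjClasses G | C.carrier.ncard = h}} =
      frobeniusKernel H \ {1} := by
    ext g
    simp only [Set.mem_ofPred_eq, Set.mem_sdiff, Set.mem_singleton_iff]
    refine ⟨fun e ↦ ?_, fun e ↦ hker g e.1 e.2⟩
    rcases hcases g with rfl | hg | hg
    · rw [hone, Set.ncard_singleton] at e; omega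
    · exact hg
    · exact absurd ((hcompl g hg).symm.trans e).symm hne
  have hset_k : {g : G | ConjClasses.mk g ∈ {C : ConjClasses G | C.carrier.ncard = k}} =
      (frobeniusKernel H)ᶜ := by
    ext g
    simp only [Set.mem_ofPred_eq, Set.mem_compl_iff]
    refine ⟨fun e ↦ ?_, fun e ↦ hcompl g e⟩
    rcases hcases g with rfl | hg | hg
    · rw [hone, Set.ncard_singleton] at e; omega
    · exact absurd ((hker g hg.1 hg.2).symm.trans e) hne
    · exact hg
  -- The counts become `k - 1 = h * _` and `k * (h - 1) = k * _`; the first also gives the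
  -- divisibility.
  rw [hset_h, Set.ncard_sdiff_singleton_of_mem (one_mem_frobeniusKernel H), hk] at hcount_h
  rw [hset_k, hH.ncard_compl_frobeniusKernel, ← hH.ncard_frobeniusKernel, hk, hh] at hcount_k
  refine ⟨⟨_, hcount_h⟩, ?_, ?_, (Nat.eq_of_mul_eq_mul_left (by omega) hcount_k).symm, ?_,
    hh ▸ hH.ncard_linear_irrCharacters hHcomm hN, ?_⟩
  · rw [Subgroup.eq_bot_iff_forall]
    intro g hg
    have hc : Subgroup.centralizer {g} = ⊤ := by
      rw [Subgroup.centralizer_eq_top_iff_subset, Set.singleton_subset_iff]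
      exact hg
    have e := ConjClasses.ncard_carrier_mk_mul_card_centralizer g
    rw [hc, Subgroup.card_top] at e
    have e' : (ConjClasses.mk g).carrier.ncard = 1 :=
      Nat.eq_of_mul_eq_mul_right Nat.card_pos (e.trans (one_mul _).symm)
    rcases hcases g with rfl | hg | hg
    · rfl
    · rw [hker g hg.1 hg.2] at e'; omega
    · rw [hcompl g hg] at e'; omega
  · rw [hcount_h, Nat.mul_div_cancel_left _ (by omega)]
  · intro C
    obtain ⟨g, rfl⟩ := ConjClasses.exists_rep C
    rcases hcases g with rfl | hg | hg
    · exact .inl hone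
    · exact .inr (.inl (hker g hg.1 hg.2))
    · exact .inr (.inr (hcompl g hg))
  · rintro _ ⟨n, ρ, hρ, rfl⟩ hlin
    have hn : Module.finrank ℂ (Fin n → ℂ) ≠ 1 := by
      intro hn
      rw [Module.finrank_fin_fun] at hn
      subst hn
      exact hlin ρ.isLinearChar_of_finrank_eq_one
    rw [Representation.char_one,
      hH.finrank_eq_card_of_isIrreducible hHcomm hN hNcomm ρ hρ hn, hh]
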